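/- Let $p\geq 5$ be a prime number, let $\mathbb{F}_q$ be a finite field of characteristic $p$, let $A=\mathbb{F}_q[T]$, and let $r$ be a prime number. Let $\mathfrak{l}$ be a nonzero prime ideal of $A$ (a finite place of $F=\mathbb{F}_q(T)$), let $A_{\mathfrak{l}}=\varprojlim_n A/\mathfrak{l}^n$ be the completion of $A$ at $\mathfrak{l}$, and let $\mathbb{F}_{\mathfrak{l}}=A/\mathfrak{l}$. Then $\mathrm{SL}_r(A_{\mathfrak{l}})$ is equal to its commutator subgroup. Moreover, the subgroup $$N:=\left\{B\in \mathrm{SL}_r(A_{\mathfrak{l}}) \;\middle|\; B\equiv \delta\cdot I_r \bmod \mathfrak{l} \text{ for some } \delta\in\mathbb{F}_{\mathfrak{l}} \text{ with } \delta^r=1\right\}$$ is normal in $\mathrm{SL}_r(A_{\mathfrak{l}})$ with simple quotient $\mathrm{SL}_r(A_{\mathfrak{l}})/N$, and it is the only normal subgroup of $\mathrm{SL}_r(A_{\mathfrak{l}})$ with simple quotient. -/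

import Mathlib

open Polynomial IsDedekindDomain

/-- `A_𝔩`: the completion of `A = k[T]` at the nonzero prime ideal `𝔩`, i.e. `lim A / 𝔩 ^ n`. -/
abbrev CompletionAt {k : Type*} [Field k] (𝔩 : HeightOneSpectrum k[X]) : Type _ :=
  AdicCompletion 𝔩.asIdeal k[X]

/-- The residue field `𝔽_𝔩 = A / 𝔩`. -/
abbrev ResidueFieldAt {k : Type*} [Field k] (𝔩 : HeightOneSpectrum k[X]) : Type _ :=
  k[X] ⧸ 𝔩.asIdeal

/-- Reduction modulo `𝔩`, from `A_𝔩` to `𝔽_𝔩`. -/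
noncomputable def redMod {k : Type*} [Field k] (𝔩 : HeightOneSpectrum k[X]) :
    CompletionAt 𝔩 →+* ResidueFieldAt 𝔩 :=
  (AdicCompletion.evalOneₐ 𝔩.asIdeal).toRingHom

/-- The subgroup of those `B ∈ SL_r(A_𝔩)` with `B ≡ δ • I_r` modulo `𝔩` for some
`δ ∈ 𝔽_𝔩` with `δ ^ r = 1`. -/
def scalarModSubgroup {k : Type*} [Field k] (r : ℕ) (𝔩 : HeightOneSpectrum k[X]) :
    Subgroup (Matrix.SpecialLinearGroup (Fin r) (CompletionAt 𝔩)) where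
  carrier := {B | ∃ δ : ResidueFieldAt 𝔩, δ ^ r = 1 ∧
    (B : Matrix (Fin r) (Fin r) (CompletionAt 𝔩)).map (redMod 𝔩) =
      δ • (1 : Matrix (Fin r) (Fin r) (ResidueFieldAt 𝔩))}
  one_mem' := ⟨1, one_pow r, by simp⟩
  mul_mem' := by
    rintro B C ⟨δ, hδ, hB⟩ ⟨ε, hε, hC⟩
    refine ⟨δ * ε, by rw [mul_pow, hδ, hε, one_mul], ?_⟩
    rw [Matrix.SpecialLinearGroup.coe_mul, Matrix.map_mul, hB, hC]
    simp [smul_smul, mul_comm]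
  inv_mem' := by
    rintro B ⟨δ, hδ, hB⟩
    rcases r with _ | n
    · exact ⟨1, by simp, Subsingleton.elim _ _⟩
    have hu : δ ^ n * δ = 1 := by rw [← pow_succ, hδ]
    refine ⟨δ ^ n, by rw [← pow_mul, mul_comm, pow_mul, hδ, one_pow], ?_⟩
    have h1 : ((B⁻¹ * B : Matrix.SpecialLinearGroup (Fin (n + 1)) (CompletionAt 𝔩)) :
        Matrix (Fin (n + 1)) (Fin (n + 1)) (CompletionAt 𝔩)).map (redMod 𝔩) = 1 := by
      simp
    rw [Matrix.SpecialLinearGroup.coe_mul, Matrix.map_mul, hB, Matrix.mul_smul, mul_one] at h1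
    rw [← h1, smul_smul, hu, one_smul]

/-! `A_𝔩` is a local ring in which 2 and 3 are units, because `p ≥ 5`. The crux is
`eq_top_of_not_scalar`: a normal subgroup containing a matrix that is not scalar modulo the maximal
ideal is everything. Conjugates and commutators of such a matrix produce an elementary transvection
with unit entry. Conjugating by diagonal matrices scales the entry by unit squares, which together
with sums reach every entry. Transvections at one position are moved to all others, and they
generate by Gaussian elimination. Since a determinant 1 matrix that is scalar modulo `𝔩` has `δ ^ r
= 1`, every proper normal subgroup lies in `N`. As `N` is proper, it is the only normal subgroup
with simple quotient. The commutator subgroup contains a transvection with entry `2 ^ 2 - 1 = 3`,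
which is not in `N`, so it is everything. -/

open Matrix

/-! ### Transvections and their conjugates. -/

namespace Matrix.SpecialLinearGroup

variable {n R : Type*} [Fintype n] [DecidableEq n] [CommRing R]

/-- The transvection `1 + v wᵀ` attached to vectors `v`, `w` with `w ⬝ᵥ v = 0`. -/
def vecTransvection (v w : n → R) (h : w ⬝ᵥ v = 0) : SpecialLinearGroup n R :=
  ⟨1 + vecMulVec v w, by
    rw [vecMulVec_eq Unit, det_one_add_replicateCol_mul_replicateRow, h, add_zero]⟩

theorem coe_vecTransvection (v w : n → R) (h : w ⬝ᵥ v = 0) :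
    (vecTransvection v w h : Matrix n n R) = 1 + vecMulVec v w := rfl

theorem vecTransvection_mulVec (v w x : n → R) (h : w ⬝ᵥ v = 0) :
    (vecTransvection v w h : Matrix n n R) *ᵥ x = x + (w ⬝ᵥ x) • v := by
  rw [coe_vecTransvection, add_mulVec, one_mulVec, vecMulVec_mulVec]
  ext i
  simp [mul_comm]

theorem vecMul_vecTransvection (v w x : n → R) (h : w ⬝ᵥ v = 0) :
    x ᵥ* (vecTransvection v w h : Matrix n n R) = x + (x ⬝ᵥ v) • w := by
  rw [coe_vecTransvection, vecMul_add, vecMul_one, vecMul_vecMulVec]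

theorem vecTransvection_mul (v v' w : n → R) (h : w ⬝ᵥ v = 0) (h' : w ⬝ᵥ v' = 0) :
    vecTransvection v w h * vecTransvection v' w h' =
      vecTransvection (v + v') w (by rw [dotProduct_add, h, h', add_zero]) := by
  apply Subtype.ext
  simp only [coe_mul, coe_vecTransvection, mul_add, add_mul, one_mul, mul_one,
    vecMulVec_mul_vecMulVec, h', add_vecMulVec, zero_smul, vecMulVec_zero, add_zero]
  abel

theorem vecTransvection_zero (w : n → R) :
    vecTransvection (0 : n → R) w (by simp) = 1 := by
  apply Subtype.ext
  simp [coe_vecTransvection]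

theorem vecTransvection_inv (v w : n → R) (h : w ⬝ᵥ v = 0) :
    (vecTransvection v w h)⁻¹ = vecTransvection (-v) w (by rw [dotProduct_neg, h, neg_zero]) := by
  rw [inv_eq_iff_mul_eq_one, vecTransvection_mul]
  simp only [add_neg_cancel, vecTransvection_zero]

theorem mul_vecTransvection_mul_inv (g : SpecialLinearGroup n R) {v w v' w' : n → R}
    (h : w ⬝ᵥ v = 0) (h' : w' ⬝ᵥ v' = 0) (hv : (g : Matrix n n R) *ᵥ v = v')
    (hw : w' ᵥ* (g : Matrix n n R) = w) :
    g * vecTransvection v w h * g⁻¹ = vecTransvection v' w' h' := by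
  rw [mul_inv_eq_iff_eq_mul]
  apply Subtype.ext
  simp only [coe_mul, coe_vecTransvection, mul_add, add_mul, one_mul, mul_one, mul_vecMulVec,
    vecMulVec_mul, hv, hw]

/-- The diagonal matrix with entries `u` at `i`, `u⁻¹` at `j` and `1` elsewhere. -/
def diagPair {i j : n} (hij : i ≠ j) (u : Rˣ) : SpecialLinearGroup n R :=
  ⟨diagonal (Function.update (Function.update 1 i (u : R)) j (↑u⁻¹ : R)), by
    rw [det_diagonal, Finset.prod_update_of_mem (Finset.mem_univ j),
      Finset.prod_update_of_mem (by simpa using hij)]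
    simp⟩

theorem coe_diagPair {i j : n} (hij : i ≠ j) (u : Rˣ) : (diagPair hij u : Matrix n n R) =
    diagonal (Function.update (Function.update 1 i (u : R)) j (↑u⁻¹ : R)) := rfl

/-- The elementary transvection `1 + x E_{ij}`. -/
def elemTransvection {i j : n} (hij : i ≠ j) (x : R) : SpecialLinearGroup n R :=
  vecTransvection (Pi.single i x) (Pi.single j 1) (by simp [hij])

theorem elemTransvection_mul {i j : n} (hij : i ≠ j) (x y : R) :
    elemTransvection hij x * elemTransvection hij y = elemTransvection hij (x + y) := by
  simp only [elemTransvection, vecTransvection_mul, Pi.single_add]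

theorem elemTransvection_inv {i j : n} (hij : i ≠ j) (x : R) :
    (elemTransvection hij x)⁻¹ = elemTransvection hij (-x) := by
  simp only [elemTransvection, vecTransvection_inv, Pi.single_neg]

theorem elemTransvection_zero {i j : n} (hij : i ≠ j) :
    elemTransvection hij (0 : R) = 1 := by
  simp only [elemTransvection, Pi.single_zero, vecTransvection_zero]

theorem diagPair_conj_elemTransvection {i j : n} (hij : i ≠ j) (u : Rˣ) (x : R) :
    diagPair hij u * elemTransvection hij x * (diagPair hij u)⁻¹ =
      elemTransvection hij ((u : R) ^ 2 * x) := by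
  rw [mul_inv_eq_iff_eq_mul]
  apply Subtype.ext
  ext a b
  simp only [coe_mul, coe_diagPair, elemTransvection, coe_vecTransvection, diagonal_mul,
    mul_diagonal, add_apply, vecMulVec_apply, one_apply, Function.update_apply, Pi.one_apply,
    Pi.single_apply]
  have := u.mul_inv
  grind

theorem elemTransvection_apply {i j : n} (hij : i ≠ j) (x : R) (a b : n) :
    elemTransvection hij x a b = (1 : Matrix n n R) a b + if a = i ∧ b = j then x else 0 := by
  change (1 + vecMulVec _ _ : Matrix n n R) a b = _
  simp only [add_apply, vecMulVec_apply, Pi.single_apply]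
  grind

theorem vecTransvection_sub_mem {H : Subgroup (SpecialLinearGroup n R)} {v v' w : n → R}
    {h : w ⬝ᵥ v = 0} {h' : w ⬝ᵥ v' = 0} {h'' : w ⬝ᵥ (v - v') = 0} (hm : vecTransvection v w h ∈ H)
    (hm' : vecTransvection v' w h' ∈ H) : vecTransvection (v - v') w h'' ∈ H := by
  have := mul_mem hm (inv_mem hm')
  rw [vecTransvection_inv, vecTransvection_mul] at this
  simpa only [sub_eq_add_neg] using this

section Normal

variable {H : Subgroup (SpecialLinearGroup n R)} [hH : H.Normal]

theorem mem_of_mul_eq_mul {A B X : SpecialLinearGroup n R} (hA : A ∈ H) (h : B * X = X * A) :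
    B ∈ H := by
  rw [eq_mul_inv_of_mul_eq h]
  exact hH.conj_mem A hA X

/-- `B` is the commutator `X A X⁻¹ A⁻¹`; the inverse-free form lets explicit matrices be checked by
multiplication alone. -/
theorem mem_of_mul_mul_eq_mul {A B X : SpecialLinearGroup n R} (hA : A ∈ H)
    (h : B * A * X = X * A) : B ∈ H :=
  (mul_mem_cancel_right hA).1 (mem_of_mul_eq_mul hA h)

theorem vecTransvection_mem_of_conj (g : SpecialLinearGroup n R) {v w v' w' : n → R}
    {h : w ⬝ᵥ v = 0} {h' : w' ⬝ᵥ v' = 0} (hm : vecTransvection v w h ∈ H)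
    (hv : (g : Matrix n n R) *ᵥ v = v') (hw : w' ᵥ* (g : Matrix n n R) = w) :
    vecTransvection v' w' h' ∈ H := by
  rw [← mul_vecTransvection_mul_inv g h h' hv hw]
  exact hH.conj_mem _ hm g

end Normal

end Matrix.SpecialLinearGroup

namespace Matrix.SpecialLinearGroup

variable {n R : Type*} [Fintype n] [DecidableEq n] [CommRing R]

theorem vecTransvection_single_mul_apply {v : n → R} {j : n}
    (h : (Pi.single j 1 : n → R) ⬝ᵥ v = 0) (g : SpecialLinearGroup n R) (a b : n) :
    (vecTransvection v (Pi.single j 1) h * g) a b = g a b + v a * g j b := by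
  change ((vecTransvection v (Pi.single j 1) h : Matrix n n R) * (g : Matrix n n R)) a b = _
  rw [coe_vecTransvection, add_mul, one_mul, vecMulVec_mul]
  simp [vecMulVec_apply]

theorem elemTransvection_mul_apply {i j : n} (hij : i ≠ j) (x : R)
    (g : SpecialLinearGroup n R) (a b : n) :
    (elemTransvection hij x * g) a b = g a b + if a = i then x * g j b else 0 := by
  rw [elemTransvection, vecTransvection_single_mul_apply, Pi.single_apply, ite_mul, zero_mul]

/-! ### Gaussian elimination over a local ring. -/

section Generation

variable {K : Subgroup (SpecialLinearGroup n R)}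

theorem vecTransvection_single_mem
    (hK : ∀ (i j : n) (hij : i ≠ j) (x : R), elemTransvection hij x ∈ K)
    {j : n} (v : n → R) (hv : (Pi.single j 1 : n → R) ⬝ᵥ v = 0) :
    vecTransvection v (Pi.single j 1) hv ∈ K := by
  have hvj : v j = 0 := by simpa using hv
  have key : ∀ (s : Finset n)
      (h : (Pi.single j 1 : n → R) ⬝ᵥ (fun i ↦ if i ∈ s then v i else 0) = 0),
      vecTransvection (fun i ↦ if i ∈ s then v i else 0) (Pi.single j 1) h ∈ K := by
    intro s
    induction s using Finset.induction_on with
    | empty =>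
      intro h
      have : vecTransvection (fun i ↦ if i ∈ (∅ : Finset n) then v i else 0) (Pi.single j 1) h
          = 1 := vecTransvection_zero _
      rw [this]
      exact one_mem K
    | insert a s has ih =>
      intro h
      by_cases haj : a = j
      · subst haj
        convert ih (by simp [hvj]) using 2
        ext i
        grind
      · have := mul_mem (hK a j haj (v a)) (ih (by simp [hvj]))
        rw [elemTransvection, vecTransvection_mul] at this
        convert this using 2
        ext i
        simp only [Pi.add_apply, Pi.single_apply]
        grind
  simpa using key Finset.univ (by simpa using hvj)

/-- The columns of `g` indexed by `S` are those of the identity matrix. -/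
def FixesCols (S : Finset n) (g : SpecialLinearGroup n R) : Prop :=
  ∀ s ∈ S, ∀ i, g i s = (1 : Matrix n n R) i s

theorem FixesCols.elemTransvection_mul {S : Finset n} {g : SpecialLinearGroup n R}
    (hg : FixesCols S g) {i j : n} (hij : i ≠ j) (hj : j ∉ S) (x : R) :
    FixesCols S (elemTransvection hij x * g) := by
  intro s hs a
  have : g j s = 0 := by rw [hg s hs, one_apply_ne (ne_of_mem_of_not_mem hs hj).symm]
  rw [elemTransvection_mul_apply, this, mul_zero, ite_self, add_zero, hg s hs]

theorem FixesCols.exists_of_apply_self_eq_one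
    (hK : ∀ (i j : n) (hij : i ≠ j) (x : R), elemTransvection hij x ∈ K)
    {S : Finset n} {g : SpecialLinearGroup n R} (hg : FixesCols S g) {j : n} (hj : j ∉ S)
    (h1 : g j j = 1) : ∃ t ∈ K, FixesCols (insert j S) (t * g) := by
  have h0 : (Pi.single j 1 : n → R) ⬝ᵥ (fun a ↦ if a = j then 0 else - g a j) = 0 := by simp
  refine ⟨_, vecTransvection_single_mem hK _ h0, fun s hs a ↦ ?_⟩
  rw [vecTransvection_single_mul_apply]
  rcases Finset.mem_insert.1 hs with rfl | hs
  · rw [h1]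
    by_cases ha : a = s
    · subst ha; simp [h1]
    · simp [ha]
  · have : g j s = 0 := by rw [hg s hs, one_apply_ne (ne_of_mem_of_not_mem hs hj).symm]
    rw [this, mul_zero, add_zero, hg s hs]

theorem FixesCols.exists_of_isUnit_apply
    (hK : ∀ (i j : n) (hij : i ≠ j) (x : R), elemTransvection hij x ∈ K)
    {S : Finset n} {g : SpecialLinearGroup n R} (hg : FixesCols S g) {j k : n} (hj : j ∉ S)
    (hk : k ∉ S) (hjk : j ≠ k) (hu : IsUnit (g k j)) :
    ∃ t ∈ K, FixesCols (insert j S) (t * g) := by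
  obtain ⟨u, hu⟩ := hu
  obtain ⟨t, ht, h⟩ := (hg.elemTransvection_mul hjk hk
    ((1 - g j j) * ↑u⁻¹)).exists_of_apply_self_eq_one hK hj
      (by rw [elemTransvection_mul_apply, if_pos rfl, ← hu]; simp)
  exact ⟨t * elemTransvection hjk _, mul_mem ht (hK _ _ _ _), by rwa [mul_assoc]⟩

/-- When only column `j` differs from the identity, the determinant is `g j j`. -/
theorem FixesCols.apply_self_eq_one {S : Finset n} {g : SpecialLinearGroup n R}
    (hg : FixesCols S g) {j : n} (hS : ∀ k, k ∉ S → k = j) : g j j = 1 := by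
  have h : (g : Matrix n n R) = (1 : Matrix n n R).updateCol j (fun i ↦ g i j) := by
    ext a b
    by_cases hb : b = j
    · subst hb; simp
    · rw [updateCol_ne hb]
      exact hg b (by_contra fun h ↦ hb (hS b h)) a
  have hd := g.det_coe
  rw [h, ← cramer_apply, cramer_one] at hd
  exact hd

theorem FixesCols.inv {S : Finset n} {g : SpecialLinearGroup n R} (hg : FixesCols S g) :
    FixesCols S g⁻¹ := by
  intro s hs i
  have h : (g : Matrix n n R) *ᵥ Pi.single s 1 = Pi.single s 1 := by
    ext a
    simpa [Pi.single_apply, one_apply] using hg s hs a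
  have h2 : ((g⁻¹ : SpecialLinearGroup n R) : Matrix n n R) *ᵥ Pi.single s 1 = Pi.single s 1 := by
    conv_lhs => rw [← h, mulVec_mulVec, ← coe_mul, inv_mul_cancel, coe_one, one_mulVec]
  simpa [Pi.single_apply, one_apply] using congrFun h2 i

/-- Expand `(g⁻¹ * g) j j = 1`: terms with index in `S` vanish because `g⁻¹` fixes the same columns,
so if the remaining `g i j` were all nonunits, 1 would lie in the maximal ideal. -/
theorem FixesCols.exists_isUnit_apply [IsLocalRing R] {S : Finset n} {g : SpecialLinearGroup n R}
    (hg : FixesCols S g) {j : n} (hj : j ∉ S) : ∃ i, i ∉ S ∧ IsUnit (g i j) := by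
  by_contra! hcon
  have h1 : (((g⁻¹ * g : SpecialLinearGroup n R)) : Matrix n n R) j j = 1 := by simp
  rw [coe_mul, mul_apply] at h1
  have h2 : (1 : R) ∈ IsLocalRing.maximalIdeal R := by
    rw [← h1]
    refine Ideal.sum_mem _ fun i _ ↦ ?_
    by_cases hi : i ∈ S
    · have : (g⁻¹ : SpecialLinearGroup n R) j i = 0 := by
        rw [hg.inv i hi, one_apply_ne (ne_of_mem_of_not_mem hi hj).symm]
      rw [this, zero_mul]
      exact zero_mem _
    · exact Ideal.mul_mem_left _ _ ((IsLocalRing.mem_maximalIdeal _).2 (hcon i hi))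
  exact (Ideal.ne_top_iff_one _).1 (IsLocalRing.maximalIdeal.isMaximal R).ne_top h2

theorem FixesCols.exists_insert [IsLocalRing R]
    (hK : ∀ (i j : n) (hij : i ≠ j) (x : R), elemTransvection hij x ∈ K)
    {S : Finset n} {g : SpecialLinearGroup n R} (hg : FixesCols S g) {j : n} (hj : j ∉ S) :
    ∃ t ∈ K, FixesCols (insert j S) (t * g) := by
  obtain ⟨i, hi, hu⟩ := hg.exists_isUnit_apply hj
  by_cases hij : j = i
  · subst hij
    by_cases hS : ∀ k, k ∉ S → k = j
    · exact hg.exists_of_apply_self_eq_one hK hj (hg.apply_self_eq_one hS)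
    -- The known unit is on the diagonal: use it to create an entry 1 in another row `k`, which then
    -- serves to correct the diagonal.
    · push Not at hS
      obtain ⟨k, hk, hkj⟩ := hS
      obtain ⟨u, hu⟩ := hu
      obtain ⟨t, ht, h⟩ := (hg.elemTransvection_mul hkj hj
        ((1 - g k j) * ↑u⁻¹)).exists_of_isUnit_apply hK hj hk hkj.symm
          (by rw [elemTransvection_mul_apply, if_pos rfl, ← hu]; simp)
      exact ⟨t * elemTransvection hkj _, mul_mem ht (hK _ _ _ _), by rwa [mul_assoc]⟩
  · exact hg.exists_of_isUnit_apply hK hj hi hij hu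

/-- Over a local ring the special linear group is generated by elementary transvections. -/
theorem eq_top_of_elemTransvection_mem [IsLocalRing R]
    (hK : ∀ (i j : n) (hij : i ≠ j) (x : R), elemTransvection hij x ∈ K) : K = ⊤ := by
  refine (Subgroup.eq_top_iff' K).2 fun g ↦ ?_
  have key : ∀ S : Finset n, ∃ t ∈ K, FixesCols S (t * g) := by
    intro S
    induction S using Finset.induction_on with
    | empty => exact ⟨1, one_mem K, fun s hs ↦ absurd hs (Finset.notMem_empty s)⟩
    | insert j S hj ih =>
      obtain ⟨t, ht, h⟩ := ih
      obtain ⟨t', ht', h'⟩ := h.exists_insert hK hj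
      exact ⟨t' * t, mul_mem ht' ht, by rwa [mul_assoc]⟩
  obtain ⟨t, ht, h⟩ := key Finset.univ
  have h1 : t * g = 1 := by
    ext i j
    exact h j (Finset.mem_univ j) i
  rw [eq_inv_of_mul_eq_one_right h1]
  exact inv_mem ht

end Generation

/-! ### Moving transvections between positions. -/

section Normal

variable {H : Subgroup (SpecialLinearGroup n R)} [hH : H.Normal]

theorem elemTransvection_mem_row {i j k : n} (hij : i ≠ j) (hkj : k ≠ j)
    (h : ∀ x : R, elemTransvection hij x ∈ H) (x : R) : elemTransvection hkj x ∈ H := by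
  by_cases hki : k = i
  · subst hki; exact h x
  have h1 : vecTransvection (Pi.single i x + Pi.single k x) (Pi.single j 1)
      (by simp [hij, hkj]) ∈ H :=
    vecTransvection_mem_of_conj (elemTransvection hki 1) (h x)
      (by rw [elemTransvection, vecTransvection_mulVec]; simp [← Pi.single_smul])
      (by rw [elemTransvection, vecMul_vecTransvection]; simp [hkj])
  have h2 := vecTransvection_sub_mem (h'' := by simp [hkj]) h1 (h x)
  rw [elemTransvection]
  simpa only [add_sub_cancel_left] using h2

theorem elemTransvection_mem_col {i j k : n} (hij : i ≠ j) (hik : i ≠ k)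
    (h : ∀ x : R, elemTransvection hij x ∈ H) (x : R) : elemTransvection hik x ∈ H := by
  by_cases hkj : j = k
  · subst hkj; exact h x
  refine (mul_mem_cancel_left (h x)).1
    (mem_of_mul_eq_mul (X := elemTransvection hkj (-1)) (h x) ?_)
  ext a b
  simp only [mul_assoc, elemTransvection_mul_apply, elemTransvection_apply, one_apply]
  grind

theorem elemTransvection_mem_swap {i j : n} (hij : i ≠ j)
    (h : ∀ x : R, elemTransvection hij x ∈ H) (x : R) : elemTransvection hij.symm x ∈ H := by
  -- `X` is the Weyl element, acting on coordinates `i`, `j` as `!![0, 1; -1, 0]`.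
  refine mem_of_mul_eq_mul (X := elemTransvection hij 1 * elemTransvection hij.symm (-1) *
    elemTransvection hij 1) (h (-x)) ?_
  ext a b
  simp only [mul_assoc, elemTransvection_mul_apply, elemTransvection_apply, one_apply]
  grind

theorem eq_top_of_forall_elemTransvection_mem [IsLocalRing R] {i j : n} (hij : i ≠ j)
    (h : ∀ x : R, elemTransvection hij x ∈ H) : H = ⊤ := by
  refine eq_top_of_elemTransvection_mem fun k l hkl ↦ ?_
  by_cases hkj : k = j
  · subst hkj
    exact elemTransvection_mem_col _ hkl (elemTransvection_mem_swap hij h)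
  · exact elemTransvection_mem_col _ hkl (elemTransvection_mem_row hij hkj h)

end Normal

end Matrix.SpecialLinearGroup

/-! ### From one unit entry to all entries. -/

/-- In a local ring where `2` is invertible, an additive subgroup which contains a unit and is
stable under multiplication by squares of units is everything. -/
theorem AddSubgroup.eq_top_of_unit_sq_mul_mem {R : Type*} [CommRing R] [IsLocalRing R]
    (h2 : IsUnit (2 : R)) (S : AddSubgroup R)
    (hS : ∀ (u : Rˣ), ∀ x ∈ S, (u : R) ^ 2 * x ∈ S) {a : R} (ha : IsUnit a) (haS : a ∈ S) :
    S = ⊤ := by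
  obtain ⟨t, ht⟩ := h2
  have hquarter : ∀ x : R, x + x + (x + x) ∈ S → x ∈ S := by
    intro x hx
    have h := hS t⁻¹ _ hx
    have e : ((t⁻¹ : Rˣ) : R) * 2 = 1 := by rw [← ht, Units.inv_mul]
    convert h using 1
    linear_combination (-x * ((t⁻¹ : Rˣ) : R) * 2 - x) * e
  have hsq : ∀ y : R, y ^ 2 * a ∈ S := by
    intro y
    by_cases hy : IsUnit y
    · obtain ⟨u, rfl⟩ := hy
      exact hS u a haS
    · have hp : IsUnit (1 + y) := by
        by_contra hc
        have h := IsLocalRing.nonunits_add (b := -y) hc (mt (IsUnit.neg_iff y).1 hy)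
        rw [add_neg_cancel_right] at h
        exact one_notMem_nonunits h
      have hm : IsUnit (1 - y) := by
        by_contra hc
        have h := IsLocalRing.nonunits_add hc hy
        rw [sub_add_cancel] at h
        exact one_notMem_nonunits h
      obtain ⟨u, hu⟩ := hp
      obtain ⟨v, hv⟩ := hm
      -- For a nonunit `y`, use `(1 + y)² + (1 - y)² - 2 = 2y²`, where `1 ± y` are units.
      have h := S.sub_mem (S.sub_mem (S.add_mem (hS u a haS) (hS v a haS)) haS) haS
      rw [hu, hv] at h
      apply hquarter
      convert S.add_mem h h using 1
      ring
  refine (AddSubgroup.eq_top_iff' S).2 fun x ↦ ?_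
  obtain ⟨b, rfl⟩ := ha
  apply hquarter
  -- With `z = x b⁻¹`, this is `(z + 1)² - (z - 1)² = 4z`.
  convert S.sub_mem (hsq (x * ↑b⁻¹ + 1)) (hsq (x * ↑b⁻¹ - 1)) using 1
  have e : ((b⁻¹ : Rˣ) : R) * b = 1 := Units.inv_mul b
  linear_combination (-4 * x) * e

/-! ### Extracting a transvection from a non-scalar matrix. -/

namespace Matrix.SpecialLinearGroup

section

variable {n R : Type*} [Fintype n] [DecidableEq n] [CommRing R]
  {H : Subgroup (SpecialLinearGroup n R)} [hH : H.Normal]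

theorem eq_top_of_isUnit_of_elemTransvection_mem [IsLocalRing R] (h2 : IsUnit (2 : R))
    {i j : n} (hij : i ≠ j) {a : R} (ha : IsUnit a) (haH : elemTransvection hij a ∈ H) :
    H = ⊤ := by
  let S : AddSubgroup R :=
    { carrier := {x | elemTransvection hij x ∈ H}
      add_mem' := fun {x y} (hx : _ ∈ H) (hy : _ ∈ H) ↦ by
        change _ ∈ H
        rw [← elemTransvection_mul]
        exact mul_mem hx hy
      zero_mem' := by
        change _ ∈ H
        rw [elemTransvection_zero]
        exact one_mem H
      neg_mem' := fun {x} (hx : _ ∈ H) ↦ by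
        change _ ∈ H
        rw [← elemTransvection_inv]
        exact inv_mem hx }
  have hS : S = ⊤ := by
    refine S.eq_top_of_unit_sq_mul_mem h2 (fun u x hx ↦ ?_) ha haH
    change elemTransvection hij _ ∈ H
    rw [← diagPair_conj_elemTransvection]
    exact hH.conj_mem _ hx _
  refine eq_top_of_forall_elemTransvection_mem hij fun x ↦ ?_
  have : x ∈ S := hS ▸ AddSubgroup.mem_top x
  exact this

/-- A special linear matrix which is not scalar modulo the maximal ideal is conjugate to one with
an invertible off-diagonal entry. -/
theorem exists_mem_isUnit_apply {F : Type*} [Field F] (f : R →+* F) [IsLocalHom f]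
    {h : SpecialLinearGroup n R} (hh : h ∈ H)
    (hs : ∀ δ : F, (h : Matrix n n R).map f ≠ δ • (1 : Matrix n n F)) :
    ∃ h' ∈ H, ∃ i j, i ≠ j ∧ IsUnit (h' i j) := by
  by_cases hoff : ∃ i j, i ≠ j ∧ IsUnit (h i j)
  · exact ⟨h, hh, hoff⟩
  push Not at hoff
  have f0 : ∀ i j, i ≠ j → f (h i j) = 0 := fun i j hij ↦ by
    by_contra hc
    exact hoff i j hij (isUnit_of_map_unit f _ (IsUnit.mk0 _ hc))
  obtain ⟨i, j, hd⟩ : ∃ i j, f (h i i) ≠ f (h j j) := by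
    by_contra! hc
    rcases isEmpty_or_nonempty n with hn | ⟨⟨i⟩⟩
    · exact hs 1 (Subsingleton.elim _ _)
    · refine hs (f (h i i)) ?_
      ext a b
      by_cases hab : a = b
      · subst hab; simpa using hc a i
      · simpa [hab] using f0 a b hab
  have hij : i ≠ j := by rintro rfl; exact hd rfl
  -- As `h` is diagonal in the residue field, this conjugate has `(i, j)` entry congruent to `h j j
  -- - h i i`.
  refine ⟨_, hH.conj_mem h hh (elemTransvection hij 1), i, j, hij,
    isUnit_of_map_unit f _ (IsUnit.mk0 _ ?_)⟩
  have hji := f0 j i hij.symm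
  have e : (elemTransvection hij 1 * h * (elemTransvection hij 1)⁻¹ : SpecialLinearGroup n R) i j
      = h i j + h j j - (h i i + h j i) := by
    rw [elemTransvection_inv, elemTransvection, elemTransvection, mul_assoc,
      vecTransvection_single_mul_apply]
    have hm : ∀ a b, (h * vecTransvection (Pi.single i (-1)) (Pi.single j 1) (by simp [hij]) :
        SpecialLinearGroup n R) a b =
        h a b + - h a i * (Pi.single j 1 : n → R) b := by
      intro a b
      change ((h : Matrix n n R) * (1 + vecMulVec _ _ : Matrix n n R)) a b = _
      rw [mul_add, mul_one, mul_vecMulVec]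
      simp [vecMulVec_apply]
    rw [hm, hm]
    simp
    ring
  rw [e, map_sub, map_add, map_add, hji, f0 i j hij, zero_add, add_zero]
  exact sub_ne_zero.2 hd.symm

/-- A matrix with an invertible off-diagonal entry is conjugate to one with a column having only
that entry. -/
theorem exists_mem_mulVec_single {h : SpecialLinearGroup n R} (hh : h ∈ H) {i j : n} (hij : i ≠ j)
    (hu : IsUnit (h i j)) :
    ∃ h' ∈ H, ∃ c : Rˣ, (h' : Matrix n n R) *ᵥ Pi.single j 1 = Pi.single i (c : R) := by
  obtain ⟨c, hc⟩ := hu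
  let y : n → R := fun a ↦ if a = i then 0 else - h a j * ↑c⁻¹
  have hy : (Pi.single i 1 : n → R) ⬝ᵥ y = 0 := by simp [y]
  refine ⟨_, hH.conj_mem h hh (vecTransvection y (Pi.single i 1) hy), c, ?_⟩
  rw [coe_mul, coe_mul, ← mulVec_mulVec, ← mulVec_mulVec, vecTransvection_inv,
    vecTransvection_mulVec, vecTransvection_mulVec]
  ext a
  by_cases ha : a = i
  · subst ha; simp [hij, y, hc]
  · simp [hij, y, ha, ← hc]
    rw [mul_left_comm, Units.mul_inv, mul_one, add_neg_cancel]

/-- Two commutators suffice. With `t = 1 + e_j e_iᵀ`, the commutator `g = [h, t]` fixes the row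
`e_kᵀ` and sends `e_i` to `(1 + β) e_i - e_j`. Hence `[g, 1 + e_i e_kᵀ] = 1 + (β e_i - e_j) e_kᵀ`,
and a final conjugation removes `β e_i`. -/
theorem elemTransvection_mem_of_mulVec_single {h : SpecialLinearGroup n R} (hh : h ∈ H)
    {i j k : n} (hij : i ≠ j) (hik : i ≠ k) (hjk : j ≠ k) {c : R}
    (hc : (h : Matrix n n R) *ᵥ Pi.single j 1 = Pi.single i c) :
    elemTransvection hjk (-1) ∈ H := by
  let t : SpecialLinearGroup n R := elemTransvection hij.symm 1
  let ρ : n → R := Pi.single i 1 ᵥ* ((h⁻¹ : SpecialLinearGroup n R) : Matrix n n R)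
  have hρ : ρ ᵥ* (h : Matrix n n R) = Pi.single i 1 := by
    rw [vecMul_vecMul, ← coe_mul, inv_mul_cancel, coe_one, vecMul_one]
  have hρ0 : ρ ⬝ᵥ Pi.single i c = 0 := by
    rw [← hc, dotProduct_mulVec, hρ]
    simp [hij]
  have hg : h * t * h⁻¹ * t⁻¹ ∈ H := by
    rw [mul_assoc, mul_assoc, ← mul_assoc t]
    exact mul_mem hh (hH.conj_mem _ (inv_mem hh) t)
  have hconj : h * t * h⁻¹ = vecTransvection (Pi.single i c) ρ hρ0 :=
    mul_vecTransvection_mul_inv h _ hρ0 hc hρ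
  let g := h * t * h⁻¹ * t⁻¹
  let β : R := (ρ i - ρ j) * c
  have hg1 : (g : Matrix n n R) *ᵥ Pi.single i 1 =
      Pi.single i (1 + β) - Pi.single j 1 := by
    simp only [g, t]
    rw [coe_mul, hconj, ← mulVec_mulVec, elemTransvection_inv, elemTransvection,
      vecTransvection_mulVec, vecTransvection_mulVec]
    ext a
    simp only [Pi.single_apply, β, Pi.add_apply, Pi.sub_apply, Pi.smul_apply, smul_eq_mul,
      dotProduct_add, dotProduct_smul, dotProduct_single]
    grind
  have hg2 : (Pi.single k 1 : n → R) ᵥ* (g : Matrix n n R) = Pi.single k 1 := by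
    simp only [g, t]
    rw [coe_mul, hconj, ← vecMul_vecMul, elemTransvection_inv, elemTransvection,
      vecMul_vecTransvection, vecMul_vecTransvection]
    simp [hik.symm, hjk.symm]
  have hA : vecTransvection (Pi.single i β - Pi.single j 1) (Pi.single k 1)
      (by simp [hik, hjk]) ∈ H := by
    have e := mul_vecTransvection_mul_inv g (v := Pi.single i 1) (w := Pi.single k 1)
      (by simp [hik]) (by simp [hik, hjk]) hg1 hg2
    have hmem : g * vecTransvection (Pi.single i 1) (Pi.single k 1) (by simp [hik]) * g⁻¹ *
        (vecTransvection (Pi.single i 1) (Pi.single k 1) (by simp [hik]))⁻¹ ∈ H := by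
      rw [mul_assoc, mul_assoc, ← mul_assoc (vecTransvection _ _ _)]
      exact mul_mem hg (hH.conj_mem _ (inv_mem hg) _)
    rw [e, vecTransvection_inv, vecTransvection_mul] at hmem
    convert hmem using 2
    rw [Pi.single_add]
    abel
  refine vecTransvection_mem_of_conj (elemTransvection hij β) hA ?_ ?_
  · rw [elemTransvection, vecTransvection_mulVec]
    ext a
    simp only [Pi.single_apply, Pi.add_apply, Pi.sub_apply, Pi.smul_apply, smul_eq_mul,
      dotProduct_sub, single_dotProduct]
    grind
  · rw [elemTransvection, vecMul_vecTransvection]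
    simp [hik.symm]

end

/-! ### The case of `2 × 2` matrices. -/

section FinTwo

variable {R : Type*} [CommRing R] {H : Subgroup (SpecialLinearGroup (Fin 2) R)} [hH : H.Normal]

/-- The matrix `!![a, b; c, d]` as an element of the special linear group. -/
def ofFinTwo (a b c d : R) (h : a * d - b * c = 1) : SpecialLinearGroup (Fin 2) R :=
  ⟨!![a, b; c, d], by rw [det_fin_two_of, h]⟩

theorem ofFinTwo_mul {a b c d a' b' c' d' : R} (h : a * d - b * c = 1)
    (h' : a' * d' - b' * c' = 1) : ofFinTwo a b c d h * ofFinTwo a' b' c' d' h' =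
      ofFinTwo (a * a' + b * c') (a * b' + b * d') (c * a' + d * c') (c * b' + d * d')
        (by linear_combination (a' * d' - b' * c') * h + h') :=
  Subtype.ext (mul_fin_two _ _ _ _ _ _ _ _)

theorem ofFinTwo_congr {a b c d a' b' c' d' : R} {h : a * d - b * c = 1}
    {h' : a' * d' - b' * c' = 1} (ha : a = a') (hb : b = b') (hc : c = c') (hd : d = d') :
    ofFinTwo a b c d h = ofFinTwo a' b' c' d' h' := by
  subst ha hb hc hd
  rfl

theorem exists_eq_ofFinTwo (g : SpecialLinearGroup (Fin 2) R) :
    ∃ h, g = ofFinTwo (g 0 0) (g 0 1) (g 1 0) (g 1 1) h :=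
  ⟨by rw [← det_fin_two, g.det_coe], Subtype.ext (eta_fin_two _)⟩

theorem elemTransvection_one_zero (x : R) :
    elemTransvection (one_ne_zero : (1 : Fin 2) ≠ 0) x = ofFinTwo 1 0 x 1 (by ring) := by
  apply Subtype.ext
  ext i j
  rw [elemTransvection_apply]
  fin_cases i <;> fin_cases j <;> simp [ofFinTwo]

/-- The commutator of `diag(2, 1/2)` with a matrix whose upper left entry is 0 is lower triangular,
with corner proportional to the trace. As `d` may vanish, `h1` and `h2` first replace the trace by
6. A second commutator with `diag(2, 1/2)` turns the diagonal `(4, 1/4)` into `(1, 1)`. -/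
theorem elemTransvection_mem_of_ofFinTwo_mem {b c d s : R} (h : 0 * d - b * c = 1)
    (hh : ofFinTwo 0 b c d h ∈ H) (hs : 2 * s = 1) :
    elemTransvection (one_ne_zero : (1 : Fin 2) ≠ 0) (27 * c * s ^ 4) ∈ H := by
  have h1 : ofFinTwo 5 (-2 * b) (2 * c) 1 (by grind) ∈ H := by
    refine mem_of_mul_mul_eq_mul (X := ofFinTwo 1 (-2 * b) 0 1 (by ring)) hh ?_
    simp only [ofFinTwo_mul]
    apply ofFinTwo_congr <;> grind
  have h2 : ofFinTwo 0 (s * b) (2 * c) 6 (by grind) ∈ H := by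
    refine mem_of_mul_eq_mul (X := ofFinTwo 1 (5 * s * b) 0 1 (by ring)) h1 ?_
    simp only [ofFinTwo_mul]
    apply ofFinTwo_congr <;> grind
  have h3 : ofFinTwo 4 0 (-9 * c) (s ^ 2) (by grind) ∈ H := by
    refine mem_of_mul_mul_eq_mul (X := ofFinTwo 2 0 0 s (by grind)) h2 ?_
    simp only [ofFinTwo_mul]
    apply ofFinTwo_congr <;> grind
  refine mem_of_mul_mul_eq_mul (X := ofFinTwo 2 0 0 s (by grind)) h3 ?_
  simp only [elemTransvection_one_zero, ofFinTwo_mul]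
  apply ofFinTwo_congr <;> grind

theorem elemTransvection_mem_of_mulVec_single_fin_two {g : SpecialLinearGroup (Fin 2) R}
    (hg : g ∈ H) {i j : Fin 2} (hij : i ≠ j) {c : Rˣ} {s : R}
    (hc : (g : Matrix (Fin 2) (Fin 2) R) *ᵥ Pi.single j 1 = Pi.single i (c : R)) (hs : 2 * s = 1) :
    ∃ c' : Rˣ, elemTransvection (one_ne_zero : (1 : Fin 2) ≠ 0) (27 * (c' : R) * s ^ 4) ∈ H := by
  obtain ⟨hd, e⟩ := exists_eq_ofFinTwo g
  have hji : g j j = 0 := by simpa [hij.symm] using congrFun hc j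
  have hii : g i j = c := by simpa using congrFun hc i
  have hneg : ((-c : Rˣ) : R) = -c := Units.val_neg c
  fin_cases i <;> fin_cases j
  · exact absurd rfl hij
  · refine ⟨-c, elemTransvection_mem_of_ofFinTwo_mem (b := - g 1 0) (d := g 0 0) (by grind) ?_ hs⟩
    rw [e] at hg
    -- The Weyl element exchanges the diagonal entries, moving the 0 to the upper left.
    refine mem_of_mul_eq_mul (X := ofFinTwo 0 1 (-1) 0 (by ring)) hg ?_
    simp only [ofFinTwo_mul]
    apply ofFinTwo_congr <;> grind
  · refine ⟨c, elemTransvection_mem_of_ofFinTwo_mem (b := g 0 1) (d := g 1 1) (by grind) ?_ hs⟩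
    rw [e] at hg
    convert hg using 1
    apply ofFinTwo_congr <;> grind
  · exact absurd rfl hij

end FinTwo

/-- Over a local ring in which `2` and `3` are invertible, a normal subgroup of the special linear
group containing a matrix that is not scalar modulo the maximal ideal is the whole group. -/
theorem eq_top_of_not_scalar {R F : Type*} [CommRing R] [IsLocalRing R] [Field F] (f : R →+* F)
    [IsLocalHom f] (h2 : IsUnit (2 : R)) (h3 : IsUnit (3 : R)) {r : ℕ}
    {H : Subgroup (SpecialLinearGroup (Fin r) R)} [hH : H.Normal]
    {h : SpecialLinearGroup (Fin r) R} (hh : h ∈ H)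
    (hs : ∀ δ : F, (h : Matrix (Fin r) (Fin r) R).map f ≠ δ • (1 : Matrix (Fin r) (Fin r) F)) :
    H = ⊤ := by
  obtain ⟨h', hh', i, j, hij, hu⟩ := exists_mem_isUnit_apply f hh hs
  obtain ⟨g, hg, c, hc⟩ := exists_mem_mulVec_single hh' hij hu
  by_cases hk : ∃ k, i ≠ k ∧ j ≠ k
  · obtain ⟨k, hik, hjk⟩ := hk
    exact eq_top_of_isUnit_of_elemTransvection_mem h2 hjk isUnit_one.neg
      (elemTransvection_mem_of_mulVec_single hg hij hik hjk hc)
  · push Not at hk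
    have hr : r = 2 := by
      rw [← Fintype.card_fin r, ← Finset.card_univ, ← Finset.card_pair hij]
      congr 1
      ext k
      have := hk k
      grind
    subst hr
    obtain ⟨t, ht⟩ := h2
    have hs : (2 : R) * ↑t⁻¹ = 1 := by rw [← ht, Units.mul_inv]
    obtain ⟨c', hc'⟩ := elemTransvection_mem_of_mulVec_single_fin_two hg hij hc hs
    refine eq_top_of_isUnit_of_elemTransvection_mem ⟨t, ht⟩ _ ?_ hc'
    have h27 : IsUnit (27 : R) := by
      have := h3.pow 3
      norm_num at this
      exact this
    exact (h27.mul c'.isUnit).mul (t⁻¹.isUnit.pow 4)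

end Matrix.SpecialLinearGroup

/-! ### Simple quotients, commutators and the completion. -/

/-- If every normal subgroup not contained in the proper normal subgroup `N` is the whole group,
then `N` is the unique normal subgroup with simple quotient. -/
theorem Subgroup.normal_and_isSimpleGroup_quotient_iff_eq {G : Type*} [Group G] {N : Subgroup G}
    (hN : N.Normal) (htop : N ≠ ⊤) (hmax : ∀ H : Subgroup G, H.Normal → ¬ H ≤ N → H = ⊤)
    (N' : Subgroup G) : (∃ _ : N'.Normal, IsSimpleGroup (G ⧸ N')) ↔ N' = N := by
  constructor
  · rintro ⟨hN', hsimple⟩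
    have hle : N' ≤ N := by
      by_contra hc
      exact QuotientGroup.nontrivial_iff.1 hsimple.toNontrivial (hmax N' hN' hc)
    have hmap : (N.map (QuotientGroup.mk' N')).Normal :=
      hN.map _ (QuotientGroup.mk'_surjective N')
    have hcomap : (N.map (QuotientGroup.mk' N')).comap (QuotientGroup.mk' N') = N := by
      rw [Subgroup.comap_map_eq, QuotientGroup.ker_mk', sup_eq_left.2 hle]
    -- The image of `N` in the simple quotient is trivial or everything; the latter would force `N =
    -- ⊤`.
    rcases hmap.eq_bot_or_eq_top with h | h
    · rw [h, MonoidHom.comap_bot, QuotientGroup.ker_mk'] at hcomap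
      exact hcomap
    · rw [h, Subgroup.comap_top] at hcomap
      exact absurd hcomap.symm htop
  · rintro rfl
    refine ⟨hN, ?_⟩
    have : Nontrivial (G ⧸ N') := QuotientGroup.nontrivial_iff.2 htop
    refine ⟨fun H hH ↦ ?_⟩
    have hsurj := QuotientGroup.mk'_surjective N'
    by_cases hle : H.comap (QuotientGroup.mk' N') ≤ N'
    · left
      rw [← Subgroup.map_comap_eq_self_of_surjective hsurj H, Subgroup.map_eq_bot_iff,
        QuotientGroup.ker_mk']
      exact hle
    · right
      rw [← Subgroup.map_comap_eq_self_of_surjective hsurj H, hmax _ (hH.comap _) hle,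
        Subgroup.map_top_of_surjective _ hsurj]

namespace Matrix.SpecialLinearGroup

variable {n R : Type*} [Fintype n] [DecidableEq n] [CommRing R]

theorem elemTransvection_mem_commutator {i j : n} (hij : i ≠ j) (u : Rˣ) (x : R) :
    elemTransvection hij (((u : R) ^ 2 - 1) * x) ∈ commutator (SpecialLinearGroup n R) := by
  have h := Subgroup.commutator_mem_commutator (Subgroup.mem_top (diagPair hij u))
    (Subgroup.mem_top (elemTransvection hij x))
  rw [commutatorElement_def, diagPair_conj_elemTransvection, elemTransvection_inv,
    elemTransvection_mul] at h
  rw [sub_one_mul, sub_eq_add_neg]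
  exact h

theorem elemTransvection_map_ne_smul_one {F : Type*} [Field F] (f : R →+* F) {i j : n}
    (hij : i ≠ j) {x : R} (hx : f x ≠ 0) (δ : F) :
    (elemTransvection hij x : Matrix n n R).map f ≠ δ • (1 : Matrix n n F) := by
  intro h
  have := congrFun (congrFun h i) j
  rw [map_apply, elemTransvection_apply] at this
  exact hx (by simpa [hij] using this)

end Matrix.SpecialLinearGroup

/-- The kernel is the ideal generated by `I`, which lies in the Jacobson radical by completeness.
Lifting the inverse of the residue of `x` to `y` gives `x * y` in `1 +` radical, hence a unit. -/
theorem AdicCompletion.isLocalHom_evalOneₐ {A : Type*} [CommRing A] (I : Ideal A) (hI : I.FG) :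
    IsLocalHom (AdicCompletion.evalOneₐ I).toRingHom := by
  refine ⟨fun x hx ↦ ?_⟩
  have hker := AdicCompletion.ker_evalOneₐ_eq_map I hI
  have := AdicCompletion.isAdicComplete_self I hI
  have hjac := IsAdicComplete.le_jacobson_bot (I.map (algebraMap A (AdicCompletion I A)))
  obtain ⟨u, hu⟩ := hx
  obtain ⟨y, hy⟩ := AdicCompletion.evalOneₐ_surjective I (↑u⁻¹ : A ⧸ I)
  have hmem : x * y - 1 ∈ RingHom.ker (AdicCompletion.evalOneₐ I) := by
    have hu' : AdicCompletion.evalOneₐ I x = u := hu.symm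
    rw [RingHom.mem_ker, map_sub, map_mul, map_one, hy, hu', Units.mul_inv, sub_self]
  have hmem' : x * y - 1 ∈ (⊥ : Ideal (AdicCompletion I A)).jacobson := by
    apply hjac
    rw [← hker]
    exact hmem
  have hunit := Ideal.mem_jacobson_bot.1 hmem' 1
  rw [mul_one, sub_add_cancel] at hunit
  exact isUnit_of_mul_isUnit_left hunit

theorem scalarModSubgroup_normal {k : Type*} [Field k] (r : ℕ) (𝔩 : HeightOneSpectrum k[X]) :
    (scalarModSubgroup r 𝔩).Normal := by
  refine ⟨?_⟩
  rintro B ⟨δ, hδ, hB⟩ g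
  have hconj : ((g * B * g⁻¹ : Matrix.SpecialLinearGroup (Fin r) (CompletionAt 𝔩)) :
      Matrix (Fin r) (Fin r) (CompletionAt 𝔩)).map (redMod 𝔩) =
        δ • (1 : Matrix (Fin r) (Fin r) (ResidueFieldAt 𝔩)) := by
    rw [Matrix.SpecialLinearGroup.coe_mul, Matrix.SpecialLinearGroup.coe_mul, Matrix.map_mul,
      Matrix.map_mul, hB, Matrix.mul_smul, mul_one, Matrix.smul_mul, ← Matrix.map_mul,
      ← Matrix.SpecialLinearGroup.coe_mul, mul_inv_cancel, Matrix.SpecialLinearGroup.coe_one, Matrix.map_one _ (map_zero _) (map_one _)]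
  exact ⟨δ, hδ, hconj⟩

/-- The condition `δ ^ r = 1` is automatic: take determinants. -/
theorem mem_scalarModSubgroup_iff {k : Type*} [Field k] {r : ℕ} {𝔩 : HeightOneSpectrum k[X]}
    {B : Matrix.SpecialLinearGroup (Fin r) (CompletionAt 𝔩)} :
    B ∈ scalarModSubgroup r 𝔩 ↔ ∃ δ : ResidueFieldAt 𝔩,
      (B : Matrix (Fin r) (Fin r) (CompletionAt 𝔩)).map (redMod 𝔩) =
        δ • (1 : Matrix (Fin r) (Fin r) (ResidueFieldAt 𝔩)) := by
  refine ⟨fun ⟨δ, _, h⟩ ↦ ⟨δ, h⟩, fun ⟨δ, h⟩ ↦ ⟨δ, ?_, h⟩⟩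
  have hdet := congrArg det h
  rw [← RingHom.mapMatrix_apply, ← RingHom.map_det, B.det_coe, map_one, det_smul, det_one,
    mul_one, Fintype.card_fin] at hdet
  exact hdet.symm

theorem isUnit_natCast_of_lt_charP {k A : Type*} [Field k] [CommRing A] (φ : k →+* A) (p : ℕ)
    [CharP k p] {m : ℕ} (hm : 0 < m) (hmp : m < p) : IsUnit (m : A) := by
  have h : (m : k) ≠ 0 := fun h ↦
    absurd (Nat.le_of_dvd hm ((CharP.cast_eq_zero_iff k p m).1 h)) (not_le.2 hmp)
  simpa using (IsUnit.mk0 _ h).map φ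

theorem lemma7p1 (p : ℕ) [Fact p.Prime] (hp : 5 ≤ p)
    (k : Type*) [Field k] [Finite k] [CharP k p]
    (r : ℕ) (hr : r.Prime) (𝔩 : HeightOneSpectrum k[X]) :
    commutator (Matrix.SpecialLinearGroup (Fin r) (CompletionAt 𝔩)) = ⊤ ∧
    ∀ N' : Subgroup (Matrix.SpecialLinearGroup (Fin r) (CompletionAt 𝔩)),
      (∃ _ : N'.Normal,
        IsSimpleGroup (Matrix.SpecialLinearGroup (Fin r) (CompletionAt 𝔩) ⧸ N')) ↔
      N' = scalarModSubgroup r 𝔩 := by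
  have hmaximal : 𝔩.asIdeal.IsMaximal := 𝔩.isMaximal
  let _ : Field (ResidueFieldAt 𝔩) := Ideal.Quotient.field 𝔩.asIdeal
  have hloc : IsLocalHom (redMod 𝔩) :=
    AdicCompletion.isLocalHom_evalOneₐ 𝔩.asIdeal (IsNoetherian.noetherian 𝔩.asIdeal)
  have : IsLocalRing (CompletionAt 𝔩) := RingHom.domain_isLocalRing (redMod 𝔩)
  let φ : k →+* CompletionAt 𝔩 := (algebraMap k[X] (CompletionAt 𝔩)).comp C
  have h2 : IsUnit (2 : CompletionAt 𝔩) := by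
    simpa using isUnit_natCast_of_lt_charP φ p (m := 2) (by omega) (by omega)
  have h3 : IsUnit (3 : CompletionAt 𝔩) := by
    simpa using isUnit_natCast_of_lt_charP φ p (m := 3) (by omega) (by omega)
  have hmax : ∀ H : Subgroup (Matrix.SpecialLinearGroup (Fin r) (CompletionAt 𝔩)), H.Normal →
      ¬ H ≤ scalarModSubgroup r 𝔩 → H = ⊤ := by
    intro H hH hle
    obtain ⟨h, hh, hN⟩ := SetLike.not_le_iff_exists.1 hle
    exact Matrix.SpecialLinearGroup.eq_top_of_not_scalar (redMod 𝔩) h2 h3 hh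
      (not_exists.1 (mt mem_scalarModSubgroup_iff.2 hN))
  have hij : (⟨0, hr.pos⟩ : Fin r) ≠ ⟨1, hr.one_lt⟩ := by simp
  have hnot : ∀ x : CompletionAt 𝔩, IsUnit x →
      Matrix.SpecialLinearGroup.elemTransvection hij x ∉ scalarModSubgroup r 𝔩 := fun x hx h ↦ by
    obtain ⟨δ, hδ⟩ := mem_scalarModSubgroup_iff.1 h
    exact Matrix.SpecialLinearGroup.elemTransvection_map_ne_smul_one (redMod 𝔩) hij
      (hx.map (redMod 𝔩)).ne_zero δ hδ
  refine ⟨hmax _ inferInstance fun hle ↦ ?_,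
    Subgroup.normal_and_isSimpleGroup_quotient_iff_eq (scalarModSubgroup_normal r 𝔩)
      (fun h ↦ hnot 1 isUnit_one (h ▸ Subgroup.mem_top _)) hmax⟩
  obtain ⟨t, ht⟩ := h2
  -- Here `u = 2` and `x = 1`, so the entry is `2 ^ 2 - 1 = 3`, a unit.
  refine hnot _ ?_ (hle (Matrix.SpecialLinearGroup.elemTransvection_mem_commutator hij t 1))
  rw [ht]
  convert h3 using 1
  norm_num
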